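/- Let $\mathfrak c=2^{\aleph_0}$. For a cardinal $\kappa$ let $[\kappa]^{\aleph_0}$ be the family of countably infinite subsets of $\kappa$, and let $\operatorname{cf}[\kappa]^{\aleph_0}$ denote the cofinality of the partially ordered set $([\kappa]^{\aleph_0},\subseteq)$. Let $B$ be a Boolean algebra. * A subalgebra $A$ of $B$ is *$\aleph_0$-ideal* if for every $b\in B\setminus A$ the ideal $\{a\in A: a<b\}$ has a countable cofinal subset. * $B$ is *$(\kappa,\aleph_0)$-ideal* if there is a family $\mathcal A$ of $\aleph_0$-ideal subalgebras of $B$, each of cardinality $\kappa$, such that every subset of $B$ of cardinality $\kappa$ is contained in a member of $\mathcal A$, and such that the union of every increasing sequence of members of $\mathcal A$ of length at most $\kappa$ and of uncountable cofinality is again in $\mathcal A$. $B$ is *$(*,\aleph_0)$-ideal* if it is $(\kappa,\aleph_0)$-ideal for every regular cardinal $\kappa<|B|$. * A subset $A$ of $B$ is *$\aleph_0$-ideal complete* if for any two countable (possibly finite or empty) sets $S,T\subseteq A$ such that $s\wedge t=0$ for all $s\in S$, $t\in T$, and such that no finite subset of $S\cup T$ has join $1$, there is $b\in B\setminus A$ such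 that for every $a\in A$: $a\le b$ if and only if $a\le\bigvee F$ for some finite $F\subseteq S$, and $a\wedge b=0$ if and only if $a\le\bigvee F$ for some finite $F\subseteq T$. The *$\mathfrak m$-number* $\mathfrak{mc}(B)$ of $B$ is the minimum cardinality of a subset of $B$ that is not $\aleph_0$-ideal complete. * $B$ is *Cohen–Parovičenko* if it is $(*,\aleph_0)$-ideal and $\mathfrak{mc}(B)=\mathfrak c$. **Theorem.** For every regular cardinal $\kappa\le\mathfrak c$ with $\operatorname{cf}[\kappa]^{\aleph_0}=\kappa$ there is a $(*,\aleph_0)$-ideal Boolean algebra $B$ of cardinality $\mathfrak c$ with $\mathfrak{mc}(B)=\kappa$. In particular, if $\mathfrak c$ is regular, then there is a Cohen–Parovičenko algebra of cardinality $\mathfrak c$. -/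

import Mathlib

open Cardinal

universe u

/-- The set of countably infinite subsets of `X`, written `[X]^ℵ₀`, ordered by inclusion. -/
abbrev CountableSubsets (X : Type u) : Type u := {s : Set X // #s = ℵ₀}

/-- The cofinality of the partially ordered set `([κ]^ℵ₀, ⊆)`. -/
noncomputable def cofCountableSubsets (κ : Cardinal.{u}) : Cardinal.{u} :=
  Order.cof (CountableSubsets κ.out)

section BooleanAlgebras

variable {B : Type u} [BooleanAlgebra B]

/-- A subalgebra `A` of `B` is `ℵ₀`-ideal if for every `b ∈ B \ A` the ideal
`{a ∈ A : a < b}` of `A` has a countable cofinal subset. -/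
def IsAlephZeroIdeal (A : BooleanSubalgebra B) : Prop :=
  ∀ b : B, b ∉ A →
    ∃ C : Set B, C.Countable ∧ C ⊆ {a | a ∈ A ∧ a < b} ∧ ∀ a ∈ A, a < b → ∃ c ∈ C, a ≤ c

/-- A family `𝒜` of subalgebras of `B` is a `κ`-cub in `[B]^κ`: all members have size `κ`, every
subset of `B` of size `κ` is contained in a member of `𝒜`, and `𝒜` is closed under unions of
increasing sequences of length at most `κ` and of uncountable cofinality. -/
structure IsCub (κ : Cardinal.{u}) (𝒜 : Set (BooleanSubalgebra B)) : Prop where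
  card_eq : ∀ A ∈ 𝒜, #A = κ
  unbounded : ∀ X : Set B, #X = κ → ∃ A ∈ 𝒜, X ⊆ A
  closed : ∀ θ : Ordinal.{u}, θ ≤ κ.ord → ℵ₀ < θ.cof →
    ∀ f : Set.Iio θ → BooleanSubalgebra B, Monotone f → (∀ ξ, f ξ ∈ 𝒜) →
      ∃ A ∈ 𝒜, (A : Set B) = ⋃ ξ, (f ξ : Set B)

/-- The ideal generated by `S`: all elements below the join of a finite subset of `S`. -/
def generatedIdeal (S : Set B) : Set B :=
  {a | ∃ F : Finset B, (F : Set B) ⊆ S ∧ a ≤ F.sup id}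

/-- A subset `A` of `B` is `ℵ₀`-ideal complete if for all countable `S, T ⊆ A` with `S ⊥ T` there is
a `b ∈ B \ A` such that `{a ∈ A : a ≤ b}` is generated by `S` and `{a ∈ A : a ∧ b = 0}` is
generated by `T`. The pairs for which the join of some finite subset of `S ∪ T` is `1` are left out:
for such a pair the only candidate for `b` is the join of the part of this finite subset that lies
in `S`, and there is nothing to be completed. -/
def IsAlephZeroIdealComplete (A : Set B) : Prop :=
  ∀ S T : Set B, S ⊆ A → T ⊆ A → S.Countable → T.Countable →
    (∀ s ∈ S, ∀ t ∈ T, s ⊓ t = ⊥) → ⊤ ∉ generatedIdeal (S ∪ T) →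
    ∃ b : B, b ∉ A ∧
      {a | a ∈ A ∧ a ≤ b} = A ∩ generatedIdeal S ∧
      {a | a ∈ A ∧ b ⊓ a = ⊥} = A ∩ generatedIdeal T

end BooleanAlgebras

section Invariants

variable (B : Type u) [BooleanAlgebra B]

/-- `B` is `(κ, ℵ₀)`-ideal: the `κ`-sized `ℵ₀`-ideal subalgebras of `B` contain a `κ`-cub. -/
def IsKappaIdeal (κ : Cardinal.{u}) : Prop :=
  ∃ 𝒜 : Set (BooleanSubalgebra B), IsCub κ 𝒜 ∧ ∀ A ∈ 𝒜, IsAlephZeroIdeal A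

/-- `B` is `(*, ℵ₀)`-ideal: it is `(κ, ℵ₀)`-ideal for every regular `κ` below `|B|`. -/
def IsStarIdeal : Prop :=
  ∀ κ : Cardinal.{u}, κ.IsRegular → κ < #B → IsKappaIdeal B κ

/-- The `𝔪`-number of `B`: the minimum cardinality of a subset of `B` that is not `ℵ₀`-ideal
complete. (If `B` has two or more elements then `B` itself is such a subset.) -/
noncomputable def emcee : Cardinal.{u} :=
  sInf {c | ∃ A : Set B, ¬ IsAlephZeroIdealComplete A ∧ #A = c}

/-- `B` is a Cohen–Parovičenko algebra. -/
def IsCohenParovicenko : Prop :=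
  IsStarIdeal B ∧ emcee B = continuum.{u}

end Invariants

/-!
The algebra `B` is the algebra of clopen sets of a closed subspace of a Cantor cube `2 ^ G`. The
subspace is cut out by constraints indexed by `G`: the value of a point at `g` is bounded from below
and from above by countably many clopen conditions on earlier coordinates
(`ConstraintSystem`). Two properties of such a system carry the proof. Points over a closed set of
coordinates extend to points of the whole space (`ConstraintSystem.exists_extension`). Hence two
points that agree on `V ∩ C`, for closed `V` and `C`, can be amalgamated, and compactness turns this
into interpolation: if `a ≤ b`, with `a` over `V` and `b` over `C`, then there is an element over
`V ∩ C` between them (`ConstraintSystem.exists_interpolant`).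

An element `b` of the algebra lives over a countable closed set `C`. So, for a closed `V`, the ideal
of elements over `V` below `b` has a cofinal set in the countable algebra over `V ∩ C`. The
subalgebras over closed sets of coordinates thus show that `B` is `(κ, ℵ₀)`-ideal for all infinite
`κ` (`ConstraintSystem.isKappaIdeal`).

For the concrete system, `cf [κ]^ℵ₀ = κ` yields a relation on `κ`, contained in the order, in which
every `α` has countably many predecessors and every countable subset of `κ` consists of predecessors
of unboundedly many `α` (`exists_ladder`). At level `α` there is a generator `u α`, constrained to
lie below `u β` for the predecessors `β` of `α`, and, for each pair `(S, T)` of countable sets of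
elements over the predecessors of `α`, a generator `x` that is constrained to lie above `S`, to be
disjoint from `T`, and to be disjoint from `u α`, where the last of these demands takes precedence
if they conflict. There is a base point at which all `u α` are true
and all other generators are false. Since `u α` lies below `u β` and `x` is disjoint from `u β` if
`x` is at level `β`, the element `u α` decides all elements over its predecessors in the way the
base point does (`Ladder.mem_iff_base_mem`). Every `b` in `B` lives over the predecessors of some
`α`, so that `u α ≤ b` or `u α ⊓ b = ⊥`. Hence nothing fills the pair `(∅, ∅)` over the set of all
`u α`, and the `𝔪`-number is at most `κ`.

Conversely, a set of fewer than `κ` elements lives before some level, because `κ` is regular. If the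
base point is outside all members of `S`, the constraint `x ⊓ u α = ⊥` does not interfere with
`S ≤ x`, and `x` fills `(S, T)` over all levels before `α`
(`Ladder.exists_filling_of_base_notMem`). Otherwise the base point is outside all members of `T`,
and the complement of the generator for `(T, S)` fills `(S, T)` (`Ladder.exists_filling`).
-/

open Set

/-! ### Well-founded constraint systems and their points -/

/-- A well-founded system of constraints on truth assignments `φ : G → Bool`. The value `φ g` is
constrained by two sequences of clopen conditions on the values of `φ` at the countably many
coordinates on which `g` depends: `lower g n` asks for `φ g = true`, and `upper g n` asks for
`φ g = false`. The conditions may conflict; a conflict is resolved in favour of the condition that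
comes first in the order `upper g 0, lower g 0, upper g 1, lower g 1, …`. -/
structure ConstraintSystem (G : Type u) where
  /-- The coordinates on which the constraint at `g` depends directly. -/
  dep : G → Set G
  countable_dep : ∀ g, (dep g).Countable
  wf : WellFounded fun h g => h ∈ dep g
  /-- The conditions that ask for the value `true` at `g`. -/
  lower : G → ℕ → Set (G → Bool)
  /-- The conditions that ask for the value `false` at `g`. -/
  upper : G → ℕ → Set (G → Bool)
  isClopen_lower : ∀ g n, IsClopen (lower g n)
  isClopen_upper : ∀ g n, IsClopen (upper g n)
  dependsOn_lower : ∀ g n, DependsOn (· ∈ lower g n) (dep g)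
  dependsOn_upper : ∀ g n, DependsOn (· ∈ upper g n) (dep g)

theorem countable_setOf_transGen {α : Type u} {r : α → α → Prop} (wf : WellFounded r)
    (hr : ∀ a, {b | r b a}.Countable) (a : α) : {b | Relation.TransGen r b a}.Countable := by
  induction a using wf.induction with
  | _ a ih =>
    refine ((hr a).union ((hr a).biUnion ih)).mono fun b hb => ?_
    rcases Relation.TransGen.tail'_iff.1 hb with ⟨c, hbc, hca⟩
    rcases Relation.reflTransGen_iff_eq_or_transGen.1 hbc with rfl | h
    · exact Or.inl hca
    · exact Or.inr (mem_biUnion (x := c) hca h)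

namespace ConstraintSystem

variable {G : Type u} (P : ConstraintSystem G)

/-- The part of the condition `lower g n` that no earlier condition overrides. -/
def lower' (g : G) (n : ℕ) : Set (G → Bool) := P.lower g n \ ⋃ m ≤ n, P.upper g m

/-- The part of the condition `upper g n` that no earlier condition overrides. -/
def upper' (g : G) (n : ℕ) : Set (G → Bool) := P.upper g n \ ⋃ m < n, P.lower g m

/-- The assignment `φ` satisfies the constraint at `g`. -/
def Satisfies (φ : G → Bool) (g : G) : Prop :=
  (∀ n, φ ∈ P.lower' g n → φ g = true) ∧ ∀ n, φ ∈ P.upper' g n → φ g = false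

/-- The assignments that satisfy all constraints, a closed subspace of the Cantor cube. -/
abbrev Point : Type u := {φ : G → Bool // ∀ g, P.Satisfies φ g}

/-- A set of coordinates is closed if it contains everything its members depend on. -/
def Closed (V : Set G) : Prop := ∀ g ∈ V, P.dep g ⊆ V

variable {P}

theorem isOpen_lower' (g : G) (n : ℕ) : IsOpen (P.lower' g n) :=
  (P.isClopen_lower g n).2.sdiff
    ((finite_le_nat n).isClosed_biUnion fun m _ => (P.isClopen_upper g m).1)

theorem isOpen_upper' (g : G) (n : ℕ) : IsOpen (P.upper' g n) :=
  (P.isClopen_upper g n).2.sdiff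
    ((finite_lt_nat n).isClosed_biUnion fun m _ => (P.isClopen_lower g m).1)

theorem dependsOn_lower' (g : G) (n : ℕ) : DependsOn (· ∈ P.lower' g n) (P.dep g) := by
  intro φ ψ h
  have h1 := P.dependsOn_lower g n h
  have h2 := fun m => P.dependsOn_upper g m h
  simp only [eq_iff_iff] at h1 h2
  simp [lower', h1, h2]

theorem dependsOn_upper' (g : G) (n : ℕ) : DependsOn (· ∈ P.upper' g n) (P.dep g) := by
  intro φ ψ h
  have h1 := P.dependsOn_upper g n h
  have h2 := fun m => P.dependsOn_lower g m h
  simp only [eq_iff_iff] at h1 h2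
  simp [upper', h1, h2]

theorem disjoint_lower'_upper' (g : G) (m n : ℕ) : Disjoint (P.lower' g m) (P.upper' g n) := by
  rw [Set.disjoint_left]
  rintro φ ⟨h1, h2⟩ ⟨h3, h4⟩
  simp only [mem_iUnion, not_exists] at h2 h4
  rcases le_or_gt n m with h | h
  · exact h2 n h h3
  · exact h4 m h h1

theorem Satisfies.congr {φ ψ : G → Bool} {g : G} (h : ∀ i ∈ P.dep g, φ i = ψ i) (hg : φ g = ψ g)
    (hφ : P.Satisfies φ g) : P.Satisfies ψ g := by
  refine ⟨fun n hn => hg ▸ hφ.1 n ?_, fun n hn => hg ▸ hφ.2 n ?_⟩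
  · exact (iff_of_eq (dependsOn_lower' g n h)).2 hn
  · exact (iff_of_eq (dependsOn_upper' g n h)).2 hn

/-- The values outside a closed set can be chosen by recursion along the dependence relation: the
relevant parts of the lower and upper conditions are disjoint, so a choice is always possible. -/
theorem exists_extension {V : Set G} (hV : P.Closed V) (φ : G → Bool)
    (hφ : ∀ g ∈ V, P.Satisfies φ g) : ∃ x : P.Point, ∀ g ∈ V, x.1 g = φ g := by
  classical
  let pad (g : G) (f : ∀ h, h ∈ P.dep g → Bool) : G → Bool :=
    fun h => if hh : h ∈ P.dep g then f h hh else false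
  let step (g : G) (f : ∀ h, h ∈ P.dep g → Bool) : Bool :=
    if g ∈ V then φ g else decide (∃ n, pad g f ∈ P.lower' g n)
  let χ : G → Bool := P.wf.fix step
  have hχ (g : G) : χ g = step g fun h _ => χ h := P.wf.fix_eq step g
  have hV' (g : G) (hg : g ∈ V) : χ g = φ g := by rw [hχ]; simp [step, hg]
  refine ⟨⟨χ, fun g => ?_⟩, hV'⟩
  by_cases hg : g ∈ V
  · exact (hφ g hg).congr (fun i hi => (hV' i (hV g hg hi)).symm) (hV' g hg).symm
  · have hpad (n : ℕ) : pad g (fun h _ => χ h) ∈ P.lower' g n ↔ χ ∈ P.lower' g n :=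
      iff_of_eq (dependsOn_lower' g n fun i hi => by simp [pad, hi])
    have hval : χ g = decide (∃ n, χ ∈ P.lower' g n) := by
      rw [hχ]; simp only [step, hg, if_false, hpad]
    refine ⟨fun n hn => ?_, fun n hn => ?_⟩
    · rw [hval]; exact decide_eq_true ⟨n, hn⟩
    · rw [hval, decide_eq_false_iff_not]
      rintro ⟨m, hm⟩
      exact Set.disjoint_left.1 (disjoint_lower'_upper' g m n) hm hn

/-- Each constraint with index in `V ∪ C` is a constraint on `V` or on `C` alone. -/
theorem exists_amalgam {V C : Set G} (hV : P.Closed V) (hC : P.Closed C) (x y : P.Point)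
    (hxy : ∀ g ∈ V ∩ C, x.1 g = y.1 g) :
    ∃ z : P.Point, (∀ g ∈ V, z.1 g = x.1 g) ∧ ∀ g ∈ C, z.1 g = y.1 g := by
  classical
  let φ : G → Bool := fun g => if g ∈ V then x.1 g else y.1 g
  have h1 (g : G) (hg : g ∈ V) : φ g = x.1 g := if_pos hg
  have h2 (g : G) (hg : g ∈ C) : φ g = y.1 g := by
    by_cases h : g ∈ V
    · rw [h1 g h, hxy g ⟨h, hg⟩]
    · exact if_neg h
  obtain ⟨z, hz⟩ := exists_extension (V := V ∪ C)
    (fun g hg => hg.elim (fun h => (hV g h).trans subset_union_left)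
      fun h => (hC g h).trans subset_union_right) φ fun g hg => hg.elim
      (fun h => (x.2 g).congr (fun i hi => (h1 i (hV g h hi)).symm) (h1 g h).symm)
      fun h => (y.2 g).congr (fun i hi => (h2 i (hC g h hi)).symm) (h2 g h).symm
  exact ⟨z, fun g hg => (hz g (Or.inl hg)).trans (h1 g hg),
    fun g hg => (hz g (Or.inr hg)).trans (h2 g hg)⟩

/-- The value at `g` can be chosen freely within the constraint. -/
theorem exists_eq_of_notMem {V : Set G} (hV : P.Closed V) {g : G} (hg : g ∉ V) (hd : P.dep g ⊆ V)
    (x : P.Point) (c : Bool) (hf : c = false → ∀ n, x.1 ∉ P.lower' g n)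
    (ht : c = true → ∀ n, x.1 ∉ P.upper' g n) :
    ∃ y : P.Point, (∀ h ∈ V, y.1 h = x.1 h) ∧ y.1 g = c := by
  classical
  have hu (h : G) (hh : h ∈ V) : Function.update x.1 g c h = x.1 h :=
    Function.update_of_ne (fun e : h = g => hg (e ▸ hh)) _ _
  have key : P.Satisfies (Function.update x.1 g c) g := by
    have hl (n : ℕ) := iff_of_eq (dependsOn_lower' (P := P) g n fun i hi => hu i (hd hi))
    have hr (n : ℕ) := iff_of_eq (dependsOn_upper' (P := P) g n fun i hi => hu i (hd hi))
    refine ⟨fun n hn => ?_, fun n hn => ?_⟩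
    · rw [Function.update_self]
      by_contra hc
      exact hf (by simpa using hc) n ((hl n).1 hn)
    · rw [Function.update_self]
      by_contra hc
      exact ht (by simpa using hc) n ((hr n).1 hn)
  obtain ⟨y, hy⟩ := exists_extension (V := insert g V)
    (by
      rintro h (rfl | hh)
      · exact hd.trans (subset_insert _ _)
      · exact (hV h hh).trans (subset_insert _ _)) (Function.update x.1 g c) (by
      rintro h (rfl | hh)
      · exact key
      · exact (x.2 h).congr (fun i hi => (hu i (hV h hh hi)).symm) (hu h hh).symm)
  exact ⟨y, fun h hh => (hy h (Or.inr hh)).trans (hu h hh),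
    (hy g (Or.inl rfl)).trans (Function.update_self ..)⟩

instance : CompactSpace P.Point := by
  refine isCompact_iff_compactSpace.1 (IsClosed.isCompact (s := {φ | ∀ g, P.Satisfies φ g}) ?_)
  have (g : G) (c : Bool) : IsClosed {φ : G → Bool | φ g = c} :=
    isClosed_eq (continuous_apply g) continuous_const
  have heq : {φ | ∀ g, P.Satisfies φ g} = ⋂ g, (⋂ n, {φ | φ ∈ P.lower' g n → φ g = true}) ∩
      ⋂ n, {φ | φ ∈ P.upper' g n → φ g = false} := by
    ext φ; simp [Satisfies]
  rw [heq]
  exact isClosed_iInter fun g => .inter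
    (isClosed_iInter fun n => isClosed_imp (isOpen_lower' g n) (this g _))
    (isClosed_iInter fun n => isClosed_imp (isOpen_upper' g n) (this g _))

theorem continuous_eval (g : G) : Continuous fun x : P.Point => x.1 g :=
  (continuous_apply g).comp continuous_subtype_val

end ConstraintSystem

/-! ### Sets of points that depend on finitely many coordinates -/

namespace ConstraintSystem

variable {G : Type u} (P : ConstraintSystem G)

/-- The algebra of those sets of points that depend on finitely many coordinates in `V`. -/
def alg (V : Set G) : BooleanSubalgebra (Set P.Point) where
  carrier := {b | ∃ F : Finset G, ↑F ⊆ V ∧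
    ∀ x y : P.Point, (∀ g ∈ F, x.1 g = y.1 g) → (x ∈ b ↔ y ∈ b)}
  supClosed' := by
    classical
    rintro a ⟨F, hF, ha⟩ b ⟨H, hH, hb⟩
    refine ⟨F ∪ H, by simp [hF, hH], fun x y hxy => or_congr ?_ ?_⟩
    · exact ha x y fun g hg => hxy g (Finset.mem_union_left _ hg)
    · exact hb x y fun g hg => hxy g (Finset.mem_union_right _ hg)
  infClosed' := by
    classical
    rintro a ⟨F, hF, ha⟩ b ⟨H, hH, hb⟩
    refine ⟨F ∪ H, by simp [hF, hH], fun x y hxy => and_congr ?_ ?_⟩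
    · exact ha x y fun g hg => hxy g (Finset.mem_union_left _ hg)
    · exact hb x y fun g hg => hxy g (Finset.mem_union_right _ hg)
  compl_mem' := by
    rintro a ⟨F, hF, ha⟩
    exact ⟨F, hF, fun x y hxy => not_congr (ha x y hxy)⟩
  bot_mem' := ⟨∅, by simp, fun x y _ => Iff.rfl⟩

/-- The set of points at which the coordinate `g` is true. -/
def coord (g : G) : Set P.Point := {x | x.1 g = true}

/-- The smallest closed set containing `W`. -/
def hull (W : Set G) : Set G := {h | ∃ g ∈ W, Relation.ReflTransGen (fun i j => i ∈ P.dep j) h g}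

variable {P}

theorem alg_mono {V W : Set G} (h : V ⊆ W) : P.alg V ≤ P.alg W :=
  fun _ ⟨F, hF, hb⟩ => ⟨F, hF.trans h, hb⟩

theorem coord_mem_alg {V : Set G} {g : G} (hg : g ∈ V) : P.coord g ∈ P.alg V :=
  ⟨{g}, by simpa using hg, fun x y h => by simp [coord, h g (by simp)]⟩

theorem mem_iff_of_mem_alg {V : Set G} {b : Set P.Point} (hb : b ∈ P.alg V) {x y : P.Point}
    (h : ∀ g ∈ V, x.1 g = y.1 g) : x ∈ b ↔ y ∈ b := by
  obtain ⟨F, hF, hb⟩ := hb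
  exact hb x y fun g hg => h g (hF hg)

theorem isClopen_of_mem_alg {V : Set G} {b : Set P.Point} (hb : b ∈ P.alg V) : IsClopen b := by
  have key {W : Set G} {a : Set P.Point} (ha : a ∈ P.alg W) : IsOpen a := by
    obtain ⟨F, -, ha⟩ := ha
    refine isOpen_iff_forall_mem_open.2 fun x hx =>
      ⟨⋂ g ∈ F, {y | y.1 g = x.1 g}, fun y hy => (ha y x fun g hg => ?_).2 hx, ?_, by simp⟩
    · simpa using mem_iInter₂.1 hy g hg
    · exact isOpen_biInter_finset fun g _ =>
        (isOpen_discrete {x.1 g}).preimage (continuous_eval g)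
  exact ⟨⟨key (BooleanSubalgebra.compl_mem hb)⟩, key hb⟩

theorem subset_hull (W : Set G) : W ⊆ P.hull W := fun g hg => ⟨g, hg, .refl⟩

theorem closed_hull (W : Set G) : P.Closed (P.hull W) :=
  fun _ ⟨i, hi, hg⟩ _ hh => ⟨i, hi, .head hh hg⟩

theorem hull_eq_biUnion (W : Set G) : P.hull W = ⋃ g ∈ W, P.hull {g} := by
  ext h; simp [hull]

theorem countable_hull_singleton (g : G) : (P.hull {g}).Countable := by
  refine ((countable_singleton g).union
    (countable_setOf_transGen P.wf P.countable_dep g)).mono ?_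
  rintro h ⟨_, rfl, hh⟩
  rcases Relation.reflTransGen_iff_eq_or_transGen.1 hh with rfl | hh
  · exact Or.inl rfl
  · exact Or.inr hh

theorem countable_hull {W : Set G} (hW : W.Countable) : (P.hull W).Countable := by
  rw [hull_eq_biUnion]
  exact hW.biUnion fun g _ => countable_hull_singleton g

/-- An element over `V` below an element over `C` is separated by an element over `V ∩ C`: otherwise
compactness yields a point of `a` and a point outside `b` that agree on `V ∩ C`, and amalgamating
them contradicts `a ⊆ b`. -/
theorem exists_interpolant {V C : Set G} (hV : P.Closed V) (hC : P.Closed C) {a b : Set P.Point}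
    (ha : a ∈ P.alg V) (hb : b ∈ P.alg C) (hab : a ⊆ b) :
    ∃ c ∈ P.alg (V ∩ C), a ⊆ c ∧ c ⊆ b := by
  classical
  by_contra! hcon
  let K (g : ↥(V ∩ C)) : Set (P.Point × P.Point) := {p | p.1.1 g = p.2.1 g}
  have hK (g : ↥(V ∩ C)) : IsClosed (K g) :=
    isClosed_eq ((continuous_eval _).comp continuous_fst) ((continuous_eval _).comp continuous_snd)
  have hab' : IsCompact (a ×ˢ bᶜ) :=
    ((isClopen_of_mem_alg ha).1.prod (isClopen_of_mem_alg hb).compl.1).isCompact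
  obtain ⟨⟨x, y⟩, ⟨hx, hy⟩, hxy⟩ := hab'.inter_iInter_nonempty K hK fun u => by
    let H : Finset G := u.image (↑)
    let c : Set P.Point := {y | ∃ x ∈ a, ∀ g ∈ H, x.1 g = y.1 g}
    have hc : c ∈ P.alg (V ∩ C) := by
      refine ⟨H, fun g hg => ?_, fun y z hyz => exists_congr fun x => and_congr_right fun _ =>
        forall₂_congr fun g hg => by rw [hyz g hg]⟩
      obtain ⟨i, -, rfl⟩ := Finset.mem_image.1 hg
      exact i.2
    obtain ⟨y, ⟨x, hx, hxy⟩, hy⟩ := Set.not_subset.1 (hcon c hc fun x hx => ⟨x, hx, fun _ _ => rfl⟩)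
    exact ⟨(x, y), ⟨hx, hy⟩, mem_iInter₂.2 fun g hg => hxy g (Finset.mem_image_of_mem _ hg)⟩
  obtain ⟨z, hzx, hzy⟩ := exists_amalgam hV hC x y fun g hg => mem_iInter.1 hxy ⟨g, hg⟩
  exact hy ((mem_iff_of_mem_alg hb hzy).1 (hab ((mem_iff_of_mem_alg ha hzx).2 hx)))

/-- An element below a new coordinate is covered by finitely many of its lower conditions: at a
point outside these conditions the value at `g` can be changed to `false`. -/
theorem subset_iUnion_lower' {V : Set G} (hV : P.Closed V) {g : G} (hg : g ∉ V)
    (hd : P.dep g ⊆ V) {a : Set P.Point} (ha : a ∈ P.alg V) (hag : a ⊆ P.coord g) :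
    ∃ N : Finset ℕ, ∀ x ∈ a, ∃ n ∈ N, x.1 ∈ P.lower' g n := by
  obtain ⟨N, hN⟩ := (isClopen_of_mem_alg ha).1.isCompact.elim_finite_subcover
    (fun n => Subtype.val ⁻¹' P.lower' g n)
    (fun n => (isOpen_lower' g n).preimage continuous_subtype_val) fun x hx => by
      by_contra hcon
      obtain ⟨y, hyx, hy⟩ := exists_eq_of_notMem hV hg hd x false
        (fun _ n hn => hcon (mem_iUnion.2 ⟨n, hn⟩)) (by simp)
      have : y.1 g = true := hag ((mem_iff_of_mem_alg ha hyx).2 hx)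
      simp [hy] at this
  exact ⟨N, fun x hx => mem_iUnion₂.1 (hN hx) |>.imp fun _ ⟨h, h'⟩ => ⟨h, h'⟩⟩

theorem subset_iUnion_upper' {V : Set G} (hV : P.Closed V) {g : G} (hg : g ∉ V)
    (hd : P.dep g ⊆ V) {a : Set P.Point} (ha : a ∈ P.alg V) (hag : Disjoint (P.coord g) a) :
    ∃ N : Finset ℕ, ∀ x ∈ a, ∃ n ∈ N, x.1 ∈ P.upper' g n := by
  obtain ⟨N, hN⟩ := (isClopen_of_mem_alg ha).1.isCompact.elim_finite_subcover
    (fun n => Subtype.val ⁻¹' P.upper' g n)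
    (fun n => (isOpen_upper' g n).preimage continuous_subtype_val) fun x hx => by
      by_contra hcon
      obtain ⟨y, hyx, hy⟩ := exists_eq_of_notMem hV hg hd x true (by simp)
        (fun _ n hn => hcon (mem_iUnion.2 ⟨n, hn⟩))
      exact Set.disjoint_left.1 hag hy ((mem_iff_of_mem_alg ha hyx).2 hx)
  exact ⟨N, fun x hx => mem_iUnion₂.1 (hN hx) |>.imp fun _ ⟨h, h'⟩ => ⟨h, h'⟩⟩

/-- A subalgebra containing the coordinates in `F` contains every set that depends only on `F`. -/
theorem mem_of_coord_mem {A : BooleanSubalgebra (Set P.Point)} (F : Finset G)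
    (hF : ∀ g ∈ F, P.coord g ∈ A) {b : Set P.Point}
    (hb : ∀ x y : P.Point, (∀ g ∈ F, x.1 g = y.1 g) → (x ∈ b ↔ y ∈ b)) : b ∈ A := by
  classical
  induction F using Finset.induction_on generalizing b with
  | empty =>
    rcases b.eq_empty_or_nonempty with rfl | ⟨x, hx⟩
    · exact A.bot_mem
    · rw [eq_univ_of_forall fun y => (hb x y (by simp)).1 hx]
      exact A.top_mem
  | insert g F _ ih =>
    have hF' : ∀ g ∈ F, P.coord g ∈ A := fun i hi => hF i (Finset.mem_insert_of_mem hi)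
    have hg := hF g (Finset.mem_insert_self _ _)
    let a (c : Bool) : Set P.Point := {x | ∃ y ∈ b, y.1 g = c ∧ ∀ i ∈ F, y.1 i = x.1 i}
    have ha (c : Bool) : a c ∈ A := ih hF' fun x z hxz => exists_congr fun y =>
      and_congr_right fun _ => and_congr_right fun _ => forall₂_congr fun i hi => by rw [hxz i hi]
    have hab (c : Bool) (x : P.Point) (hx : x.1 g = c) : x ∈ a c ↔ x ∈ b := by
      refine ⟨fun ⟨y, hy, hyg, hyx⟩ => (hb y x fun i hi => ?_).1 hy,
        fun h => ⟨x, h, hx, fun _ _ => rfl⟩⟩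
      rcases Finset.mem_insert.1 hi with rfl | hi
      · rw [hyg, hx]
      · exact hyx i hi
    have : b = (a true ⊓ P.coord g) ⊔ (a false ⊓ (P.coord g)ᶜ) := by
      ext x
      by_cases hx : x.1 g = true
      · simp [coord, hx, hab true x hx]
      · simp [coord, hx, hab false x (by simpa using hx)]
    rw [this]
    exact A.sup_mem (A.inf_mem (ha _) hg) (A.inf_mem (ha _) (A.compl_mem hg))

/-- A set that depends only on the coordinates in `F` is given by finitely many patterns on `F`. -/
theorem exists_patterns {ι : Type u} (f : ι → G) (F : Finset ι) {b : Set P.Point}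
    (hb : ∀ x y : P.Point, (∀ i ∈ F, x.1 (f i) = y.1 (f i)) → (x ∈ b ↔ y ∈ b)) :
    ∃ Q : Finset (Finset ι), ∀ x : P.Point, x ∈ b ↔ F.filter (fun i => x.1 (f i) = true) ∈ Q := by
  classical
  refine ⟨F.powerset.filter fun q => ∃ x ∈ b, F.filter (fun i => x.1 (f i) = true) = q,
    fun x => ⟨fun hx => ?_, fun hx => ?_⟩⟩
  · exact Finset.mem_filter.2 ⟨Finset.mem_powerset.2 (Finset.filter_subset _ _), x, hx, rfl⟩
  · obtain ⟨-, y, hy, hyx⟩ := Finset.mem_filter.1 hx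
    refine (hb y x fun i hi => Bool.eq_iff_iff.2 ?_).1 hy
    simpa [hi] using congrArg (i ∈ ·) hyx

theorem mk_finset_le (α : Type u) : #(Finset α) ≤ max #α ℵ₀ := by
  rcases finite_or_infinite α with h | h
  · exact (mk_le_aleph0 (α := Finset α)).trans (le_max_right _ _)
  · exact (mk_finset_of_infinite α).le.trans (le_max_left _ _)

theorem mk_alg_le (V : Set G) : #(P.alg V) ≤ max #V ℵ₀ := by
  classical
  let e (τ : Finset V × Finset (Finset V)) : Set P.Point :=
    {x | τ.1.filter (fun i : V => x.1 i = true) ∈ τ.2}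
  have hsub : (P.alg V : Set (Set P.Point)) ⊆ range e := by
    rintro b ⟨F, hF, hb⟩
    obtain ⟨Q, hQ⟩ := exists_patterns (Subtype.val : V → G) (F.subtype (· ∈ V)) (b := b)
      fun x y h => hb x y fun g hg => h ⟨g, hF hg⟩ (by simpa using hg)
    exact ⟨(F.subtype (· ∈ V), Q), by ext x; exact (hQ x).symm⟩
  calc #(P.alg V) ≤ #(range e) := mk_le_mk_of_subset hsub
    _ ≤ #(Finset V × Finset (Finset V)) := mk_range_le
    _ = #(Finset V) * #(Finset (Finset V)) := by simp
    _ ≤ max #V ℵ₀ * max #V ℵ₀ := mul_le_mul' (mk_finset_le _)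
        ((mk_finset_le _).trans (max_le (mk_finset_le _) (le_max_right _ _)))
    _ = max #V ℵ₀ := mul_eq_self (le_max_right _ _)

end ConstraintSystem

/-! ### The algebra of a constraint system is ideal in every infinite cardinality -/

namespace ConstraintSystem

variable {G : Type u} (P : ConstraintSystem G)

/-- The Boolean algebra generated by the coordinates, the sets of points that depend on finitely
many coordinates. -/
abbrev Algebra : Type u := ↥(P.alg univ)

/-- `P.alg V` as a subalgebra of the whole algebra. -/
def sub (V : Set G) : BooleanSubalgebra P.Algebra where
  carrier := {b | b.1 ∈ P.alg V}
  supClosed' _ ha _ hb := (P.alg V).sup_mem ha hb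
  infClosed' _ ha _ hb := (P.alg V).inf_mem ha hb
  compl_mem' ha := (P.alg V).compl_mem ha
  bot_mem' := (P.alg V).bot_mem

/-- The generator of the algebra with index `g`. -/
def gen (g : G) : P.Algebra := ⟨P.coord g, coord_mem_alg (mem_univ g)⟩

variable {P}

theorem gen_mem_sub {V : Set G} {g : G} (hg : g ∈ V) : P.gen g ∈ P.sub V := coord_mem_alg hg

theorem sub_mono {V W : Set G} (h : V ⊆ W) : P.sub V ≤ P.sub W := fun _ hb => alg_mono h hb

/-- `P.sub V` is generated by the generators with index in `V`. -/
theorem sub_le {V : Set G} {A : BooleanSubalgebra P.Algebra} (h : ∀ g ∈ V, P.gen g ∈ A) :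
    P.sub V ≤ A := by
  rintro b ⟨F, hF, hb⟩
  let A' : BooleanSubalgebra (Set P.Point) :=
    { carrier := {a | ∃ c ∈ A, c.1 = a}
      supClosed' := by
        rintro _ ⟨c, hc, rfl⟩ _ ⟨d, hd, rfl⟩
        exact ⟨c ⊔ d, A.sup_mem hc hd, rfl⟩
      infClosed' := by
        rintro _ ⟨c, hc, rfl⟩ _ ⟨d, hd, rfl⟩
        exact ⟨c ⊓ d, A.inf_mem hc hd, rfl⟩
      compl_mem' := by
        rintro _ ⟨c, hc, rfl⟩
        exact ⟨cᶜ, A.compl_mem hc, rfl⟩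
      bot_mem' := ⟨⊥, A.bot_mem, rfl⟩ }
  obtain ⟨c, hc, hcb⟩ := mem_of_coord_mem (A := A') F (fun g hg => ⟨P.gen g, h g (hF hg), rfl⟩) hb
  rwa [← Subtype.ext hcb]

theorem mk_sub_le (V : Set G) : #(P.sub V) ≤ max #V ℵ₀ := by
  refine le_trans (mk_le_of_injective (f := fun b : P.sub V => (⟨b.1.1, b.2⟩ : P.alg V)) ?_)
    (mk_alg_le V)
  intro a b h
  exact Subtype.ext (Subtype.ext (Subtype.mk.inj h))

theorem exists_finset (b : P.Algebra) : ∃ F : Finset G, b ∈ P.sub (F : Set G) := by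
  obtain ⟨F, -, hb⟩ := b.2
  exact ⟨F, F, le_rfl, hb⟩

/-- The part of a subalgebra over a closed set below `b` is controlled, by interpolation, by a
countable subalgebra. -/
theorem isAlephZeroIdeal_sub {V : Set G} (hV : P.Closed V) : IsAlephZeroIdeal (P.sub V) := by
  intro b hb
  obtain ⟨F, hF⟩ := exists_finset b
  have hC : (P.hull F).Countable := countable_hull F.countable_toSet
  refine ⟨{c | c ∈ P.sub (V ∩ P.hull F) ∧ c < b}, .mono (fun c hc => hc.1) ?_,
    fun c hc => ⟨sub_mono inter_subset_left hc.1, hc.2⟩, fun a ha hab => ?_⟩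
  · rw [← le_aleph0_iff_set_countable]
    refine (mk_sub_le _).trans (max_le ?_ le_rfl)
    exact le_aleph0_iff_set_countable.2 (hC.mono inter_subset_right)
  · obtain ⟨c, hc, hac, hcb⟩ := exists_interpolant hV (closed_hull F) ha
      (alg_mono (subset_hull (F : Set G)) hF) hab.le
    have hcV : c ∈ P.alg V := alg_mono inter_subset_left hc
    let c' : P.Algebra := ⟨c, alg_mono (subset_univ _) hcV⟩
    refine ⟨c', ⟨hc, lt_of_le_of_ne hcb ?_⟩, hac⟩
    rintro rfl
    exact hb hcV

theorem closed_iUnion {ι : Sort*} {V : ι → Set G} (hV : ∀ i, P.Closed (V i)) :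
    P.Closed (⋃ i, V i) := fun g hg => by
  obtain ⟨i, hi⟩ := mem_iUnion.1 hg
  exact (hV i g hi).trans (subset_iUnion V i)

theorem coe_sub_iUnion {ι : Type*} [LinearOrder ι] [Nonempty ι] {V : ι → Set G}
    {f : ι → BooleanSubalgebra P.Algebra} (hf : Monotone f) (hV : ∀ i, f i = P.sub (V i)) :
    (P.sub (⋃ i, V i) : Set P.Algebra) = ⋃ i, (f i : Set P.Algebra) := by
  refine subset_antisymm (fun b hb => ?_) (iUnion_subset fun i => ?_)
  · obtain ⟨F, hF, hb⟩ := hb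
    have hgen (g : F) : ∃ i, P.gen g ∈ f i := by
      obtain ⟨i, hi⟩ := mem_iUnion.1 (hF g.2)
      exact ⟨i, hV i ▸ gen_mem_sub hi⟩
    choose k hk using hgen
    obtain ⟨M, hM⟩ := Finite.exists_le k
    have hle : P.sub F ≤ f M := sub_le fun g hg => hf (hM ⟨g, hg⟩) (hk ⟨g, hg⟩)
    have hb' : b ∈ P.sub F := ⟨F, subset_rfl, hb⟩
    exact mem_iUnion.2 ⟨M, hle hb'⟩
  · rw [hV]
    exact sub_mono (subset_iUnion V i)

/-- The subalgebras over closed sets of coordinates form the required cub. -/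
theorem isKappaIdeal {κ : Cardinal.{u}} (hκ : ℵ₀ ≤ κ) : IsKappaIdeal P.Algebra κ := by
  let 𝒜 : Set (BooleanSubalgebra P.Algebra) := {A | #A = κ ∧ ∃ V, P.Closed V ∧ A = P.sub V}
  refine ⟨𝒜, ⟨fun A hA => hA.1, fun X hX => ?_, fun θ hθ hcof f hf hmem => ?_⟩, ?_⟩
  · choose F hF using exists_finset (P := P)
    let W : Set G := ⋃ b : X, P.hull (F b)
    have hFW (b : X) : (F b : Set G) ⊆ W :=
      (subset_hull _).trans (subset_iUnion (fun b : X => P.hull (F b)) b)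
    have hXW : X ⊆ P.sub W := fun b hb => sub_mono (hFW ⟨b, hb⟩) (hF b)
    refine ⟨P.sub W, ⟨le_antisymm ?_ ?_, W, closed_iUnion fun b => closed_hull _, rfl⟩, hXW⟩
    · refine (mk_sub_le W).trans (max_le ?_ hκ)
      refine (mk_iUnion_le _).trans ?_
      rw [hX]
      refine (mul_le_mul' le_rfl (ciSup_le' fun b : X => ?_)).trans (mul_eq_self hκ).le
      exact (le_aleph0_iff_set_countable.2 (countable_hull (F b).countable_toSet)).trans hκ
    · exact hX ▸ mk_le_mk_of_subset hXW
  · have hθ0 : 0 < θ := pos_iff_ne_zero.2 fun h => by simp [h] at hcof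
    have : Nonempty (Iio θ) := ⟨⟨0, hθ0⟩⟩
    choose hcard V hV hfV using hmem
    have heq := coe_sub_iUnion hf hfV
    refine ⟨P.sub (⋃ ξ, V ξ), ⟨le_antisymm ?_ ?_, _, closed_iUnion hV, rfl⟩, heq⟩
    · change #(P.sub (⋃ ξ, V ξ) : Set P.Algebra) ≤ κ
      rw [heq, ← lift_le.{u + 1}]
      refine (mk_iUnion_le_lift _).trans ?_
      rw [mk_Iio_ordinal, lift_lift]
      refine (mul_le_mul' (lift_le.2 (card_le_of_le_ord hθ)) (ciSup_le' fun ξ => ?_)).trans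
        (mul_eq_self (aleph0_le_lift.2 hκ)).le
      exact lift_le.2 (hcard ξ).le
    · rw [← hcard ⟨0, hθ0⟩, hfV]
      exact mk_le_mk_of_subset (sub_mono (subset_iUnion V _))
  · rintro A ⟨-, V, hV, rfl⟩
    exact isAlephZeroIdeal_sub hV

end ConstraintSystem

/-! ### Cofinal families of countable sets and ladders -/

theorem exists_gt_of_mk_lt {κ : Cardinal.{u}} (hκ : κ.IsRegular) {Y : Set κ.ord.ToType}
    (hY : #Y < κ) : ∃ γ, ∀ y ∈ Y, y < γ := by
  by_contra! h
  have : IsCofinal Y := h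
  have := Order.cof_le this
  rw [Ordinal.cof_toType, hκ.cof_ord] at this
  exact absurd hY this.not_gt

/-- The cofinality of `[ω]^ℵ₀` is `1`, because `ω` is its largest element. -/
theorem aleph0_lt_of_cofCountableSubsets_eq {κ : Cardinal.{u}} (hκ : ℵ₀ ≤ κ)
    (hcof : cofCountableSubsets κ = κ) : ℵ₀ < κ := by
  refine lt_of_le_of_ne hκ ?_
  rintro rfl
  have htop : IsCofinal ({⟨univ, by simp⟩} : Set (CountableSubsets (ℵ₀ : Cardinal.{u}).out)) :=
    fun s => ⟨_, rfl, subset_univ s.1⟩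
  have := Order.cof_le htop
  rw [mk_singleton, show Order.cof _ = _ from hcof] at this
  exact absurd this one_lt_aleph0.not_ge

theorem exists_mem_superset_of_isCofinal {X : Type u} [Infinite X] {𝒞 : Set (CountableSubsets X)}
    (h : IsCofinal 𝒞) {Y : Set X} (hY : Y.Countable) : ∃ c ∈ 𝒞, Y ⊆ c.1 := by
  have f := Infinite.natEmbedding X
  have hZ : #(Y ∪ range f : Set X) = ℵ₀ := by
    refine le_antisymm (le_aleph0_iff_set_countable.2 (hY.union (countable_range f))) ?_
    refine aleph0_le_mk_iff.2 (infinite_coe_iff.2 ?_)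
    exact (infinite_range_of_injective f.injective).mono subset_union_right
  obtain ⟨c, hc, hZc⟩ := h ⟨_, hZ⟩
  exact ⟨c, hc, subset_union_left.trans hZc⟩

/-- A relation on `K`, contained in the strict order, in which every element has countably many
predecessors, enumerated (with gaps) by `enum`. -/
structure Ladder (K : Type u) [LinearOrder K] where
  enum : K → ℕ → Option K
  lt_of_enum : ∀ α n β, enum α n = some β → β < α

/-- The predecessors of `α`. -/
def Ladder.below {K : Type u} [LinearOrder K] (D : Ladder K) (α : K) : Set K :=
  {β | ∃ n, D.enum α n = some β}

theorem exists_enum {X : Type u} {s : Set X} (hs : s.Countable) :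
    ∃ e : ℕ → Option X, ∀ x, (∃ n, e n = some x) ↔ x ∈ s := by
  have := hs.toEncodable
  refine ⟨fun n => (Encodable.decode n : Option s).map (↑), fun x => ⟨?_, fun hx => ?_⟩⟩
  · rintro ⟨n, hn⟩
    obtain ⟨y, -, rfl⟩ := Option.map_eq_some_iff.1 hn
    exact y.2
  · exact ⟨Encodable.encode (⟨x, hx⟩ : s), by simp⟩

/-- The predecessors of `α` are those elements below `α` of the `α`-th member of a cofinal family of
countable sets, listed so that each of its members occurs unboundedly often. -/
theorem exists_ladder {κ : Cardinal.{u}} (hκ : κ.IsRegular) (hcof : cofCountableSubsets κ = κ) :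
    ∃ D : Ladder κ.ord.ToType,
      ∀ X : Set κ.ord.ToType, X.Countable → ∀ β, ∃ α, β < α ∧ X ⊆ D.below α := by
  have hω := aleph0_lt_of_cofCountableSubsets_eq hκ.aleph0_le hcof
  obtain ⟨𝒞, h𝒞, hcard⟩ := Order.exists_cof_eq (CountableSubsets κ.out)
  replace hcard : #𝒞 = κ := hcard.trans hcof
  have : Infinite κ.out := by rw [infinite_iff, mk_out]; exact hκ.aleph0_le
  obtain ⟨e⟩ : Nonempty (κ.out ≃ κ.ord.ToType) := Cardinal.eq.1 (by simp)
  obtain ⟨p⟩ : Nonempty (κ.ord.ToType ≃ 𝒞 × κ.ord.ToType) := Cardinal.eq.1 (by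
    simp [hcard, mul_eq_self hκ.aleph0_le])
  have hcount (α : κ.ord.ToType) : {β | β < α ∧ e.symm β ∈ (p α).1.1.1}.Countable := by
    have hc : ((p α).1.1.1).Countable := le_aleph0_iff_set_countable.1 (p α).1.1.2.le
    exact (hc.preimage e.symm.injective).mono fun β h => h.2
  choose enum henum using fun α => exists_enum (hcount α)
  refine ⟨⟨enum, fun α n β h => ((henum α β).1 ⟨n, h⟩).1⟩, fun X hX β => ?_⟩
  obtain ⟨c, hc, hXc⟩ := exists_mem_superset_of_isCofinal h𝒞 (hX.preimage e.injective)
  obtain ⟨γ, hγ⟩ := exists_gt_of_mk_lt hκ (Y := insert β X)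
    ((le_aleph0_iff_set_countable.2 (hX.insert β)).trans_lt hω)
  -- `c` is listed `κ` many times, hence also above `γ`
  obtain ⟨k, hk⟩ : ∃ k, γ ≤ p.symm (⟨c, hc⟩, k) := by
    by_contra! h
    have hinj : Function.Injective fun k => (⟨p.symm (⟨c, hc⟩, k), h k⟩ : Iio γ) :=
      fun k l hkl => by simpa using Subtype.mk.inj hkl
    have := mk_le_of_injective hinj
    rw [mk_ord_toType] at this
    exact absurd ((mk_Iio_lt γ (by simp)).trans_eq (mk_ord_toType κ)) this.not_gt
  refine ⟨_, (hγ β (mem_insert _ _)).trans_le hk, fun x hx => (henum _ x).2 ⟨?_, ?_⟩⟩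
  · exact (hγ x (mem_insert_of_mem _ hx)).trans_le hk
  · rw [p.apply_symm_apply]
    exact hXc (by simpa using hx)

/-- There are only `𝔠` countable subsets, and fewer than `𝔠` of them do not cover a set of size
`𝔠`. -/
theorem cofCountableSubsets_continuum : cofCountableSubsets 𝔠 = (𝔠 : Cardinal.{u}) := by
  have hX : #(𝔠 : Cardinal.{u}).out = 𝔠 := mk_out _
  have : Infinite (𝔠 : Cardinal.{u}).out := by rw [infinite_iff, hX]; exact aleph0_le_continuum
  refine le_antisymm ?_ (Order.le_cof_iff.2 fun 𝒞 h𝒞 => ?_)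
  · refine (Order.cof_le_cardinalMk _).trans ?_
    calc #(CountableSubsets (𝔠 : Cardinal.{u}).out)
        ≤ #{t : Set (𝔠 : Cardinal.{u}).out // #t ≤ ℵ₀} :=
          mk_subtype_le_of_subset fun s (hs : #s = ℵ₀) => hs.le
      _ ≤ 𝔠 ^ (ℵ₀ : Cardinal.{u}) := by
          simpa [hX] using mk_bounded_set_le_of_infinite (𝔠 : Cardinal.{u}).out ℵ₀
      _ = 𝔠 := continuum_power_aleph0
  · have hcov : (⋃ c : 𝒞, c.1.1) = Set.univ := eq_univ_of_forall fun x => by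
      obtain ⟨c, hc, hx⟩ := exists_mem_superset_of_isCofinal h𝒞 (countable_singleton x)
      exact mem_iUnion.2 ⟨⟨c, hc⟩, hx rfl⟩
    have hle : 𝔠 ≤ #𝒞 * ℵ₀ := by
      refine hX.ge.trans ?_
      rw [← mk_univ, ← hcov]
      exact (mk_iUnion_le _).trans (mul_le_mul' le_rfl (ciSup_le' fun c : 𝒞 => c.1.2.le))
    by_contra! hlt
    have := hle.trans (mul_le_max _ _)
    exact absurd this (by simp [hlt, aleph0_lt_continuum])

/-! ### The constraint system of a ladder -/

/-- A code for a clopen set of assignments: a finite set of coordinates with a finite set of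
patterns. -/
abbrev Code (G : Type u) : Type u := Finset G × Finset (Finset G)

namespace Code

variable {G : Type u}

/-- The set of assignments whose trace on the coordinates of `τ` is one of the patterns. -/
def eval (τ : Code G) : Set (G → Bool) := {φ | τ.1.filter (fun g => φ g = true) ∈ τ.2}

theorem dependsOn_eval (τ : Code G) : DependsOn (· ∈ τ.eval) (τ.1 : Set G) := by
  intro φ ψ h
  have : τ.1.filter (fun g => φ g = true) = τ.1.filter (fun g => ψ g = true) :=
    Finset.filter_congr fun g hg => by rw [h g hg]
  simp [eval, this]

theorem isOpen_of_dependsOn {s : Set (G → Bool)} {F : Finset G}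
    (h : DependsOn (· ∈ s) (F : Set G)) : IsOpen s := by
  refine isOpen_iff_forall_mem_open.2 fun φ hφ =>
    ⟨⋂ g ∈ F, {χ | χ g = φ g}, fun χ hχ => ?_, ?_, by simp⟩
  · refine (iff_of_eq (h fun g hg => ?_)).2 hφ
    simpa using mem_iInter₂.1 hχ g hg
  · exact isOpen_biInter_finset fun g _ =>
      (isOpen_discrete {φ g}).preimage (continuous_apply (A := fun _ => Bool) g)

theorem isClopen_of_dependsOn {s : Set (G → Bool)} {F : Finset G}
    (h : DependsOn (· ∈ s) (F : Set G)) : IsClopen s :=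
  ⟨⟨isOpen_of_dependsOn (F := F) fun _ _ hx => congrArg Not (h hx)⟩, isOpen_of_dependsOn h⟩

@[simp] theorem eval_empty : eval ((∅, ∅) : Code G) = ∅ := by
  ext; simp [eval]

end Code

namespace Ladder

variable {K J : Type u} [LinearOrder K] (D : Ladder K)

theorem countable_below (α : K) : (D.below α).Countable := by
  refine (countable_range fun n => (D.enum α n).getD α).mono ?_
  rintro β ⟨n, hn⟩
  exact ⟨n, by simp [hn]⟩

variable {D} in
theorem lt_of_mem_below {α β : K} (h : β ∈ D.below α) : β < α := D.lt_of_enum _ _ _ h.choose_spec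

/-- The indices of the generators. At each level `α` there are a generator `(α, none)` and the
generators `(α, some (j, i))`, where `j` codes the pair to be filled and `i` only serves to repeat
the generator. -/
abbrev Index (K J : Type u) : Type u := K × Option (J × J)

open Classical in
/-- Replaces a code that does not live below `α` by a code for the empty set. -/
noncomputable def guard (α : K) (τ : Code (Index K J)) : Code (Index K J) :=
  if ∀ g ∈ τ.1, g.1 ∈ D.below α then τ else (∅, ∅)

theorem below_of_mem_guard {α : K} {τ : Code (Index K J)} {g} (hg : g ∈ (D.guard α τ).1) :
    g.1 ∈ D.below α := by
  unfold guard at hg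
  split_ifs at hg with h
  · exact h g hg
  · simp at hg

theorem guard_eq_self {α : K} {τ : Code (Index K J)}
    (hτ : (τ.1 : Set (Index K J)) ⊆ {g | g.1 ∈ D.below α}) : D.guard α τ = τ :=
  if_pos fun _ hg => hτ hg

variable (decode : J → (ℕ → Code (Index K J)) × (ℕ → Code (Index K J)))

/-- `(α, none)` depends on the `(β, none)` with `β` below `α`, and `(α, some j)` depends on
`(α, none)` and on the coordinates of the codes listed by `j`. -/
def dep : Index K J → Set (Index K J)
  | (α, none) => (fun β => (β, none)) '' D.below α
  | (α, some j) => insert (α, none) (⋃ n, ((D.guard α ((decode j.1).1 n)).1 : Set (Index K J)) ∪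
      (D.guard α ((decode j.1).2 n)).1)

/-- The lower conditions: none for `(α, none)`, and the first sequence of codes for
`(α, some j)`. -/
def lower : Index K J → ℕ → Set (Index K J → Bool)
  | (_, none), _ => ∅
  | (α, some j), n => (D.guard α ((decode j.1).1 n)).eval

/-- The upper conditions. Those for `(α, none)` keep it below all `(β, none)` with `β` below `α`.
The first one for `(α, some j)` makes it disjoint from `(α, none)`, and the others are given by the
second sequence of codes. -/
def upper : Index K J → ℕ → Set (Index K J → Bool)
  | (α, none), n => {φ | ∃ β, D.enum α n = some β ∧ φ (β, none) = false}
  | (α, some _), 0 => {φ | φ (α, none) = true}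
  | (α, some j), n + 1 => (D.guard α ((decode j.1).2 n)).eval

theorem lt_or_of_mem_dep {g h : Index K J} (hh : h ∈ D.dep decode g) :
    h.1 < g.1 ∨ h.1 = g.1 ∧ h.2 = none ∧ g.2 ≠ none := by
  obtain ⟨α, _ | j⟩ := g
  · obtain ⟨β, hβ, rfl⟩ := hh
    exact Or.inl (lt_of_mem_below hβ)
  · rcases hh with rfl | hh
    · simp
    · obtain ⟨n, hn | hn⟩ := mem_iUnion.1 hh
      all_goals exact Or.inl (lt_of_mem_below (D.below_of_mem_guard hn))

theorem exists_finset_lower (g : Index K J) (n : ℕ) :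
    ∃ F : Finset (Index K J), ↑F ⊆ D.dep decode g ∧
      DependsOn (· ∈ D.lower decode g n) (F : Set (Index K J)) := by
  obtain ⟨α, _ | j⟩ := g
  · exact ⟨∅, by simp, fun _ _ _ => rfl⟩
  · exact ⟨_, fun h hh => Or.inr (mem_iUnion.2 ⟨n, Or.inl hh⟩), Code.dependsOn_eval _⟩

theorem exists_finset_upper (g : Index K J) (n : ℕ) :
    ∃ F : Finset (Index K J), ↑F ⊆ D.dep decode g ∧
      DependsOn (· ∈ D.upper decode g n) (F : Set (Index K J)) := by
  obtain ⟨α, _ | j⟩ := g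
  · cases h : D.enum α n with
    | none => exact ⟨∅, by simp, fun _ _ _ => by simp [upper, h]⟩
    | some β =>
      refine ⟨{(β, none)}, ?_, fun φ χ hφ => ?_⟩
      · rw [Finset.coe_singleton, singleton_subset_iff]
        exact ⟨β, ⟨n, h⟩, rfl⟩
      · simp [upper, h, hφ (β, none) (by simp)]
  · cases n with
    | zero =>
      refine ⟨{(α, none)}, ?_, fun φ χ hφ => ?_⟩
      · rw [Finset.coe_singleton, singleton_subset_iff]
        exact mem_insert _ _
      · simp [upper, hφ (α, none) (by simp)]
    | succ n => exact ⟨_, fun h hh => Or.inr (mem_iUnion.2 ⟨n, Or.inr hh⟩), Code.dependsOn_eval _⟩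

variable [WellFoundedLT K]

/-- The constraint system of a ladder. -/
def system : ConstraintSystem (Index K J) where
  dep := D.dep decode
  countable_dep := by
    rintro ⟨α, _ | j⟩
    · exact (D.countable_below α).image _
    · exact (countable_iUnion fun n =>
        (Finset.countable_toSet _).union (Finset.countable_toSet _)).insert _
  wf := by
    refine Subrelation.wf (r := InvImage (Prod.Lex (· < ·) (· < ·))
      fun g : Index K J => (g.1, if g.2 = none then 0 else 1)) (fun {h g} hh => ?_)
      (InvImage.wf _ (WellFounded.prod_lex wellFounded_lt (wellFounded_lt (α := ℕ))))
    rcases D.lt_or_of_mem_dep decode hh with hlt | ⟨h1, h2, h3⟩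
    · exact Prod.Lex.left _ _ hlt
    · exact Prod.lex_def.2 (Or.inr ⟨h1, by simp [h2, h3]⟩)
  lower := D.lower decode
  upper := D.upper decode
  isClopen_lower g n :=
    let ⟨_, _, hF⟩ := D.exists_finset_lower decode g n
    Code.isClopen_of_dependsOn hF
  isClopen_upper g n :=
    let ⟨_, _, hF⟩ := D.exists_finset_upper decode g n
    Code.isClopen_of_dependsOn hF
  dependsOn_lower g n :=
    let ⟨_, hF, h⟩ := D.exists_finset_lower decode g n
    h.mono hF
  dependsOn_upper g n :=
    let ⟨_, hF, h⟩ := D.exists_finset_upper decode g n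
    h.mono hF

/-- The base point, at which the generators `(α, none)` are true and all others false. -/
def base : (D.system decode).Point := ⟨fun g => g.2.isNone, by
  rintro ⟨α, _ | j⟩
  · refine ⟨fun n hn => rfl, fun n hn => ?_⟩
    obtain ⟨β, -, h⟩ := hn.1
    simp at h
  · refine ⟨fun n hn => absurd ?_ hn.2, fun n hn => rfl⟩
    exact mem_iUnion₂.2 ⟨0, Nat.zero_le _, rfl⟩⟩

variable {D decode}

theorem eq_isNone_of_mem_below {x : (D.system decode).Point} {α : K}
    (hx : x.1 (α, none) = true) {g : Index K J} (hg : g.1 ∈ D.below α) : x.1 g = g.2.isNone := by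
  have hu {β : K} (hβ : β ∈ D.below α) : x.1 (β, none) = true := by
    obtain ⟨n, hn⟩ := hβ
    by_contra hc
    have := (x.2 (α, none)).2 n ⟨⟨β, hn, by simpa using hc⟩, by
      simp [system, lower]⟩
    simp [hx] at this
  obtain ⟨β, _ | j⟩ := g
  · exact hu hg
  · refine (x.2 (β, some j)).2 0 ⟨hu hg, by simp⟩

/-- `gen (α, none)` decides every element over `D.below α`, with the value at the base point. -/
theorem mem_iff_base_mem {x : (D.system decode).Point} {α : K} (hx : x.1 (α, none) = true)
    {b : (D.system decode).Algebra} (hb : b ∈ (D.system decode).sub {g | g.1 ∈ D.below α}) :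
    x ∈ b.1 ↔ D.base decode ∈ b.1 :=
  ConstraintSystem.mem_iff_of_mem_alg hb fun _ hg => eq_isNone_of_mem_below hx hg

end Ladder

/-! ### Filling a pair of countable sets -/

theorem generatedIdeal_mono {B : Type u} [BooleanAlgebra B] {S T : Set B} (h : S ⊆ T) :
    generatedIdeal S ⊆ generatedIdeal T :=
  fun _ ⟨F, hF, ha⟩ => ⟨F, hF.trans h, ha⟩

theorem le_of_mem_generatedIdeal {B : Type u} [BooleanAlgebra B] {S : Set B} {a c : B}
    (h : ∀ s ∈ S, s ≤ c) (ha : a ∈ generatedIdeal S) : a ≤ c := by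
  obtain ⟨F, hF, ha⟩ := ha
  exact ha.trans (Finset.sup_le fun s hs => h s (hF hs))

theorem sup_mem_generatedIdeal {B : Type u} [BooleanAlgebra B] {S : Set B} {a b : B}
    (ha : a ∈ generatedIdeal S) (hb : b ∈ generatedIdeal S) : a ⊔ b ∈ generatedIdeal S := by
  classical
  obtain ⟨F, hF, ha⟩ := ha
  obtain ⟨H, hH, hb⟩ := hb
  refine ⟨F ∪ H, by simp [hF, hH], ?_⟩
  rw [Finset.sup_union]
  exact sup_le_sup ha hb

theorem mem_generatedIdeal_of_le_sup {B : Type u} [BooleanAlgebra B] {S : Set B} {s : ℕ → B}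
    (hs : ∀ n, s n ∈ insert ⊥ S) {a : B} {N : Finset ℕ} (ha : a ≤ N.sup s) :
    a ∈ generatedIdeal S := by
  classical
  refine ⟨(N.image s).erase ⊥, fun b hb => ?_, ?_⟩
  · obtain ⟨hb0, hb⟩ := Finset.mem_erase.1 hb
    obtain ⟨n, -, rfl⟩ := Finset.mem_image.1 hb
    exact (hs n).resolve_left hb0
  · rwa [Finset.sup_erase_bot, Finset.sup_image]

theorem exists_seq_insert_bot {B : Type u} [BooleanAlgebra B] {S : Set B} (hS : S.Countable) :
    ∃ s : ℕ → B, (∀ n, s n ∈ insert ⊥ S) ∧ ∀ b ∈ S, ∃ n, s n = b := by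
  obtain ⟨s, hs⟩ := (hS.insert ⊥).exists_eq_range (insert_nonempty _ _)
  exact ⟨s, fun n => hs ▸ mem_range_self n, fun b hb => hs.subset (mem_insert_of_mem _ hb)⟩

namespace ConstraintSystem

variable {G : Type u} {P : ConstraintSystem G}

theorem mem_sup_iff {N : Finset ℕ} {s : ℕ → P.Algebra} {x : P.Point} :
    x ∈ (N.sup s).1 ↔ ∃ n ∈ N, x ∈ (s n).1 := by
  classical
  induction N using Finset.induction_on with
  | empty => simp
  | insert n N _ ih => simp [Finset.sup_insert, ih]

theorem exists_code {V : Set G} {b : P.Algebra} (hb : b ∈ P.sub V) :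
    ∃ τ : Code G, ↑τ.1 ⊆ V ∧ ∀ x : P.Point, x ∈ b.1 ↔ x.1 ∈ τ.eval := by
  obtain ⟨F, hF, hb⟩ := hb
  obtain ⟨Q, hQ⟩ := exists_patterns id F hb
  exact ⟨(F, Q), hF, hQ⟩

end ConstraintSystem

namespace Ladder

open ConstraintSystem

variable {K J : Type u} [LinearOrder K] [WellFoundedLT K] {D : Ladder K}
  {decode : J → (ℕ → Code (Index K J)) × (ℕ → Code (Index K J))}

theorem closed_setOf_fst_lt (α : K) : (D.system decode).Closed {g | g.1 < α} := by
  intro g hg h (hh : h ∈ D.dep decode g)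
  rcases D.lt_or_of_mem_dep decode hh with hlt | ⟨heq, -⟩
  · exact lt_trans hlt hg
  · exact heq.trans_lt hg

theorem dep_none_subset (α : K) : (D.system decode).dep (α, none) ⊆ {g | g.1 < α} := by
  intro h (hh : h ∈ D.dep decode (α, none))
  rcases D.lt_or_of_mem_dep decode hh with hlt | ⟨-, -, hne⟩
  · exact hlt
  · exact absurd rfl hne

theorem dep_some_subset (α : K) (j : J × J) :
    (D.system decode).dep (α, some j) ⊆ insert (α, none) {g | g.1 < α} := by
  intro h (hh : h ∈ D.dep decode (α, some j))
  rcases D.lt_or_of_mem_dep decode hh with hlt | ⟨h1, h2, -⟩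
  · exact Or.inr hlt
  · exact Or.inl (Prod.ext h1 h2)

theorem closed_insert {V : Set (Index K J)} (hV : (D.system decode).Closed V) {g : Index K J}
    (hg : (D.system decode).dep g ⊆ V) : (D.system decode).Closed (insert g V) := by
  rintro h (rfl | hh)
  · exact hg.trans (subset_insert _ _)
  · exact (hV h hh).trans (subset_insert _ _)

/-- No nonzero element over the levels before `α` lies below `gen (α, none)`. -/
theorem eq_bot_of_le_gen_none {α : K} {a : (D.system decode).Algebra}
    (ha : a ∈ (D.system decode).sub {g | g.1 < α}) (hle : a ≤ (D.system decode).gen (α, none)) :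
    a = ⊥ := by
  obtain ⟨N, hN⟩ := subset_iUnion_lower' (closed_setOf_fst_lt α) (by simp)
    (dep_none_subset α) ha hle
  refine Subtype.ext (eq_empty_of_forall_notMem fun x hx => ?_)
  obtain ⟨n, -, hn⟩ := hN x hx
  exact hn.1

/-- If `S` avoids the base point, then the generator at level `α` with code for `(S, T)` fills the
pair `(S, T)` over all levels before `α`. -/
theorem exists_filling_of_base_notMem (hdec : Function.Surjective decode) {α : K}
    {S T : Set (D.system decode).Algebra} (hS : S.Countable) (hT : T.Countable)
    (hSα : ∀ s ∈ S, s ∈ (D.system decode).sub {g | g.1 ∈ D.below α})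
    (hTα : ∀ t ∈ T, t ∈ (D.system decode).sub {g | g.1 ∈ D.below α})
    (hST : ∀ s ∈ S, ∀ t ∈ T, s ⊓ t = ⊥) (hbase : ∀ s ∈ S, D.base decode ∉ s.1) :
    ∃ b : (D.system decode).Algebra, ∀ a ∈ (D.system decode).sub {g | g.1 < α},
      (a ≤ b ↔ a ∈ generatedIdeal S) ∧ (b ⊓ a = ⊥ ↔ a ∈ generatedIdeal T) := by
  obtain ⟨s, hs, hsS⟩ := exists_seq_insert_bot hS
  obtain ⟨t, ht, htT⟩ := exists_seq_insert_bot hT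
  have hsα (n : ℕ) : s n ∈ (D.system decode).sub {g | g.1 ∈ D.below α} := by
    rcases hs n with h | h
    · rw [h]; exact BooleanSubalgebra.bot_mem
    · exact hSα _ h
  have htα (n : ℕ) : t n ∈ (D.system decode).sub {g | g.1 ∈ D.below α} := by
    rcases ht n with h | h
    · rw [h]; exact BooleanSubalgebra.bot_mem
    · exact hTα _ h
  have hsbase (n : ℕ) : D.base decode ∉ (s n).1 := by
    rcases hs n with h | h
    · rw [h]; exact id
    · exact hbase _ h
  have hst (n m : ℕ) (x : (D.system decode).Point) (hx : x ∈ (s n).1) (hx' : x ∈ (t m).1) :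
      False := by
    have : s n ⊓ t m = ⊥ := by
      rcases hs n with h | h
      · rw [h, bot_inf_eq]
      · rcases ht m with h' | h'
        · rw [h', inf_bot_eq]
        · exact hST _ h _ h'
    have hx'' : x ∈ (s n ⊓ t m).1 := ⟨hx, hx'⟩
    rw [this] at hx''
    exact hx''
  choose σ hσα hσ using fun n => exists_code (hsα n)
  choose τ hτα hτ using fun n => exists_code (htα n)
  obtain ⟨j, hj⟩ := hdec (σ, τ)
  let g : Index K J := (α, some (j, j))
  have hlower (x : (D.system decode).Point) (n : ℕ) :
      x.1 ∈ (D.system decode).lower g n ↔ x ∈ (s n).1 := by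
    change x.1 ∈ (D.guard α ((decode j).1 n)).eval ↔ _
    rw [hj, guard_eq_self D (hσα n), hσ]
  have hupper_succ (x : (D.system decode).Point) (n : ℕ) :
      x.1 ∈ (D.system decode).upper g (n + 1) ↔ x ∈ (t n).1 := by
    change x.1 ∈ (D.guard α ((decode j).2 n)).eval ↔ _
    rw [hj, guard_eq_self D (hτα n), hτ]
  -- since `gen (α, none)` decides `s n` negatively, the first upper bound does not affect `s n`
  have hs_le (n : ℕ) : s n ≤ (D.system decode).gen g := by
    intro x hx
    refine (x.2 g).1 n ⟨(hlower x n).2 hx, fun h => ?_⟩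
    obtain ⟨m, -, hm⟩ := mem_iUnion₂.1 h
    cases m with
    | zero => exact hsbase n ((mem_iff_base_mem hm (hsα n)).1 hx)
    | succ m => exact hst n m x hx ((hupper_succ x m).1 hm)
  have ht_inf (n : ℕ) : t n ≤ ((D.system decode).gen g)ᶜ := by
    intro x hx hxg
    have : x.1 g = false := (x.2 g).2 (n + 1) ⟨(hupper_succ x n).2 hx, fun h => by
      obtain ⟨m, -, hm⟩ := mem_iUnion₂.1 h
      exact hst m n x ((hlower x m).1 hm) hx⟩
    exact Bool.false_ne_true (this.symm.trans hxg)
  have hV' := closed_insert (closed_setOf_fst_lt (decode := decode) α) (dep_none_subset (D := D) α)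
  have hg : g ∉ insert (α, none) {h : Index K J | h.1 < α} := by simp [g]
  have hd := dep_some_subset (D := D) (decode := decode) α (j, j)
  refine ⟨(D.system decode).gen g, fun a ha => ?_⟩
  have ha' : a.1 ∈ (D.system decode).alg (insert (α, none) {h | h.1 < α}) :=
    alg_mono (subset_insert _ _) ha
  refine ⟨⟨fun hle => ?_, ?_⟩, ⟨fun hdisj => ?_, ?_⟩⟩
  · obtain ⟨N, hN⟩ := subset_iUnion_lower' hV' hg hd ha' hle
    refine mem_generatedIdeal_of_le_sup hs (N := N) fun x hx => mem_sup_iff.2 ?_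
    obtain ⟨n, hn, hxn⟩ := hN x hx
    exact ⟨n, hn, (hlower x n).1 hxn.1⟩
  · refine le_of_mem_generatedIdeal fun b hb => ?_
    obtain ⟨n, rfl⟩ := hsS b hb
    exact hs_le n
  · obtain ⟨N, hN⟩ := subset_iUnion_upper' hV' hg hd ha'
      (Set.disjoint_iff_inter_eq_empty.2 (congrArg Subtype.val hdisj))
    -- outside the join of `T` only the first upper bound is left, and it is harmless
    -- the upper condition with index `n + 1` is `t n`
    let N' := N.image Nat.pred
    have hbelow : {g : Index K J | g.1 ∈ D.below α} ⊆ {g | g.1 < α} :=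
      fun g hg => lt_of_mem_below hg
    have hle : a ⊓ (N'.sup t)ᶜ ≤ (D.system decode).gen (α, none) := by
      rintro x ⟨hx, hxt⟩
      obtain ⟨n, hn, hxn, -⟩ := hN x hx
      cases n with
      | zero => exact hxn
      | succ n =>
        exact absurd (mem_sup_iff.2 ⟨n, Finset.mem_image_of_mem Nat.pred hn,
          (hupper_succ x n).1 hxn⟩) hxt
    have hmem : a ⊓ (N'.sup t)ᶜ ∈ (D.system decode).sub {g | g.1 < α} := by
      refine BooleanSubalgebra.inf_mem ha (BooleanSubalgebra.compl_mem ?_)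
      exact Finset.sup_induction BooleanSubalgebra.bot_mem
        (fun _ h₁ _ h₂ => BooleanSubalgebra.sup_mem h₁ h₂)
        fun n _ => sub_mono hbelow (htα n)
    refine mem_generatedIdeal_of_le_sup ht (N := N') ?_
    exact disjoint_compl_right_iff.1 (disjoint_iff.2 (eq_bot_of_le_gen_none hmem hle))
  · intro h
    have : a ≤ ((D.system decode).gen g)ᶜ := le_of_mem_generatedIdeal (fun b hb => by
      obtain ⟨n, rfl⟩ := htT b hb
      exact ht_inf n) h
    exact (le_compl_iff_disjoint_left.1 this).eq_bot

/-- At most one of the two sides of an orthogonal pair meets the base point, so either the generator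
for `(S, T)` or the complement of the generator for `(T, S)` fills the pair. -/
theorem exists_filling (hdec : Function.Surjective decode) {α : K}
    {S T : Set (D.system decode).Algebra} (hS : S.Countable) (hT : T.Countable)
    (hSα : ∀ s ∈ S, s ∈ (D.system decode).sub {g | g.1 ∈ D.below α})
    (hTα : ∀ t ∈ T, t ∈ (D.system decode).sub {g | g.1 ∈ D.below α})
    (hST : ∀ s ∈ S, ∀ t ∈ T, s ⊓ t = ⊥) :
    ∃ b : (D.system decode).Algebra, ∀ a ∈ (D.system decode).sub {g | g.1 < α},
      (a ≤ b ↔ a ∈ generatedIdeal S) ∧ (b ⊓ a = ⊥ ↔ a ∈ generatedIdeal T) := by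
  by_cases hbase : ∀ s ∈ S, D.base decode ∉ s.1
  · exact exists_filling_of_base_notMem hdec hS hT hSα hTα hST hbase
  · push Not at hbase
    obtain ⟨s, hs, hbs⟩ := hbase
    obtain ⟨b, hb⟩ := exists_filling_of_base_notMem hdec hT hS hTα hSα
      (fun t ht s hs => by rw [inf_comm]; exact hST s hs t ht) fun t ht hbt => by
        have h : D.base decode ∈ (s ⊓ t).1 := ⟨hbs, hbt⟩
        rw [hST s hs t ht] at h
        exact h
    refine ⟨bᶜ, fun a ha => ⟨?_, ?_⟩⟩
    · rw [← (hb a ha).2, le_compl_iff_disjoint_left, disjoint_iff]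
    · rw [← (hb a ha).1, inf_comm, ← disjoint_iff, disjoint_compl_right_iff]

/-- If all of `A` lives before level `β`, a pair of countable subsets of `A` is filled at any level
`α` after `β` whose predecessors include all levels that occur in the pair. -/
theorem isAlephZeroIdealComplete_of_subset (hdec : Function.Surjective decode)
    (hD : ∀ X : Set K, X.Countable → ∀ β, ∃ α, β < α ∧ X ⊆ D.below α) {β : K}
    {A : Set (D.system decode).Algebra} (hA : A ⊆ (D.system decode).sub {g | g.1 < β}) :
    IsAlephZeroIdealComplete A := by
  intro S T hSA hTA hS hT hST htop
  choose F hF using exists_finset (P := D.system decode)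
  obtain ⟨α, hβα, hα⟩ := hD (⋃ b ∈ S ∪ T, Prod.fst '' (F b : Set (Index K J)))
    ((hS.union hT).biUnion fun b _ => (F b).countable_toSet.image _) β
  have hmem (b) (hb : b ∈ S ∪ T) : b ∈ (D.system decode).sub {g | g.1 ∈ D.below α} := by
    have hsub : (F b : Set (Index K J)) ⊆ {g | g.1 ∈ D.below α} :=
      fun g hg => hα (mem_biUnion hb (mem_image_of_mem _ hg))
    exact sub_mono hsub (hF b)
  have hAα : A ⊆ (D.system decode).sub {g | g.1 < α} := by
    have hsub : {g : Index K J | g.1 < β} ⊆ {g | g.1 < α} := fun g hg => lt_trans hg hβα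
    exact hA.trans (sub_mono hsub)
  obtain ⟨b, hb⟩ := exists_filling hdec hS hT (fun s hs => hmem s (Or.inl hs))
    (fun t ht => hmem t (Or.inr ht)) hST
  refine ⟨b, fun hbA => htop ?_, ?_, ?_⟩
  · have h1 := (hb b (hAα hbA)).1.1 le_rfl
    have h2 := (hb bᶜ (BooleanSubalgebra.compl_mem (hAα hbA))).2.1 inf_compl_eq_bot
    rw [← sup_compl_eq_top (x := b)]
    exact sup_mem_generatedIdeal (generatedIdeal_mono subset_union_left h1)
      (generatedIdeal_mono subset_union_right h2)
  · ext a
    exact and_congr_right fun ha => (hb a (hAα ha)).1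
  · ext a
    exact and_congr_right fun ha => (hb a (hAα ha)).2

/-- The generators `(α, none)` decide all elements of the algebra, so nothing fills the pair
`(∅, ∅)` over them. -/
theorem not_isAlephZeroIdealComplete_range
    (hD : ∀ X : Set K, X.Countable → ∃ α, X ⊆ D.below α) :
    ¬ IsAlephZeroIdealComplete (range fun α => (D.system decode).gen (α, none)) := by
  intro h
  have hbot (a : (D.system decode).Algebra) (ha : a ∈ generatedIdeal (∅ : Set _)) : a = ⊥ := by
    exact le_bot_iff.1 (le_of_mem_generatedIdeal (by simp) ha)
  have hne (a : (D.system decode).Algebra) (ha : D.base decode ∈ a.1) : a ≠ ⊥ := by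
    rintro rfl
    exact ha
  obtain ⟨b, -, h1, h2⟩ := h ∅ ∅ (empty_subset _) (empty_subset _) countable_empty countable_empty
    (by simp) (by rw [union_empty]; exact fun ht => hne ⊤ trivial (hbot ⊤ ht))
  obtain ⟨F, hF⟩ := exists_finset b
  obtain ⟨α, hα⟩ := hD (Prod.fst '' (F : Set (Index K J))) (F.countable_toSet.image _)
  have hsub : (F : Set (Index K J)) ⊆ {g | g.1 ∈ D.below α} :=
    fun g hg => hα (mem_image_of_mem _ hg)
  have hb := sub_mono hsub hF
  have hu := hne ((D.system decode).gen (α, none)) rfl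
  by_cases hbase : D.base decode ∈ b.1
  · exact hu (hbot _ (h1.subset ⟨⟨α, rfl⟩, fun x hx => (mem_iff_base_mem hx hb).2 hbase⟩).2)
  · refine hu (hbot _ (h2.subset ⟨⟨α, rfl⟩, ?_⟩).2)
    exact Subtype.ext (eq_empty_of_forall_notMem fun x hx =>
      hbase ((mem_iff_base_mem hx.2 hb).1 hx.1))

/-- The generators `(α, some (j, i))`, where `j` codes a pair of sequences of empty sets, are
pairwise distinct: apart from being disjoint from `(α, none)` they are unconstrained. -/
theorem mk_le_mk_algebra [Nonempty K] (hdec : Function.Surjective decode) :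
    #J ≤ #(D.system decode).Algebra := by
  obtain ⟨α⟩ := ‹Nonempty K›
  obtain ⟨j, hj⟩ := hdec (fun _ => (∅, ∅), fun _ => (∅, ∅))
  have hguard : D.guard α ((∅, ∅) : Code (Index K J)) = (∅, ∅) := guard_eq_self D (by simp)
  have hlower (i : J) (n : ℕ) : (D.system decode).lower (α, some (j, i)) n = ∅ := by
    change (D.guard α ((decode j).1 n)).eval = ∅
    simp [hj, hguard]
  have hupper (i : J) (n : ℕ) : (D.system decode).upper (α, some (j, i)) (n + 1) = ∅ := by
    change (D.guard α ((decode j).2 n)).eval = ∅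
    simp [hj, hguard]
  have hV := closed_setOf_fst_lt (D := D) (decode := decode) α
  have hd := dep_none_subset (D := D) (decode := decode) α
  have hV' := closed_insert hV hd
  obtain ⟨x, -, hx⟩ := exists_eq_of_notMem hV (by simp) hd (D.base decode) false
    (fun _ n hn => hn.1) (by simp)
  refine mk_le_of_injective (f := fun i => (D.system decode).gen (α, some (j, i)))
    fun i k (hik : (D.system decode).gen _ = (D.system decode).gen _) => ?_
  by_contra hne
  have hd' (l : J) := dep_some_subset (D := D) (decode := decode) α (j, l)
  obtain ⟨y, hyx, hy⟩ := exists_eq_of_notMem hV' (g := (α, some (j, i))) (by simp) (hd' i) x true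
    (by simp) fun _ n hn => by
      cases n with
      | zero => exact Bool.false_ne_true (hx.symm.trans hn.1)
      | succ n => exact (hupper i n).subset hn.1
  obtain ⟨z, hzy, hz⟩ := exists_eq_of_notMem (closed_insert hV' (hd' i)) (g := (α, some (j, k)))
    (by simp [Ne.symm hne]) ((hd' k).trans (subset_insert _ _)) y false
    (fun _ n hn => (hlower k n).subset hn.1) (by simp)
  have hzi : z ∈ ((D.system decode).gen (α, some (j, i))).1 :=
    (hzy _ (mem_insert _ _)).trans hy
  have hzk : z ∈ ((D.system decode).gen (α, some (j, k))).1 := hik ▸ hzi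
  exact Bool.false_ne_true (hz.symm.trans hzk)

end Ladder

/-! ### Cardinalities and the algebra -/

theorem mk_code_le {G : Type u} {c : Cardinal.{u}} (hc : ℵ₀ ≤ c) (hG : #G ≤ c) : #(Code G) ≤ c := by
  have h {X : Type u} (hX : #X ≤ c) : #(Finset X) ≤ c :=
    (ConstraintSystem.mk_finset_le X).trans (max_le hX hc)
  rw [mk_prod, lift_id, lift_id]
  exact (mul_le_mul' (h hG) (h (h hG))).trans (mul_eq_self hc).le

theorem exists_surjective_decode {J C : Type u} [Nonempty C] (hJ : #J = 𝔠) (hC : #C ≤ 𝔠) :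
    ∃ decode : J → (ℕ → C) × (ℕ → C), Function.Surjective decode := by
  have hseq : #(ℕ → C) ≤ 𝔠 := by
    rw [mk_arrow, lift_uzero, mk_nat, lift_aleph0]
    exact (power_le_power_right hC).trans continuum_power_aleph0.le
  have : #((ℕ → C) × (ℕ → C)) ≤ #J := by
    rw [mk_prod, lift_id, hJ]
    exact (mul_le_mul' hseq hseq).trans continuum_mul_self.le
  obtain ⟨f⟩ := this
  exact ⟨Function.invFun f, Function.invFun_surjective f.injective⟩

/-- A set of fewer than `κ` elements lives below some level and is therefore complete, while the `κ`
many generators `(α, none)` form a set that is not. -/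
theorem exists_isStarIdeal_emcee_eq {κ : Cardinal.{0}} (hκ : κ.IsRegular) (hκc : κ ≤ 𝔠)
    (hcof : cofCountableSubsets κ = κ) :
    ∃ (B : Type) (_ : BooleanAlgebra B), #B = 𝔠 ∧ IsStarIdeal B ∧ emcee B = κ := by
  have hω := aleph0_lt_of_cofCountableSubsets_eq hκ.aleph0_le hcof
  obtain ⟨D, hD⟩ := exists_ladder hκ hcof
  have hJ : #(Set ℕ) = 𝔠 := by simp
  have hK : Nonempty κ.ord.ToType := by
    rw [← mk_ne_zero_iff, mk_ord_toType]; exact hκ.pos.ne'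
  have hG : #(Ladder.Index κ.ord.ToType (Set ℕ)) ≤ 𝔠 := by
    rw [mk_prod, lift_id, lift_id, mk_ord_toType, mk_option, mk_prod, lift_id, hJ,
      continuum_mul_self]
    refine (mul_le_mul' hκc (add_le_add_right (one_le_aleph0.trans aleph0_le_continuum) 𝔠)).trans ?_
    simp
  obtain ⟨decode, hdec⟩ := exists_surjective_decode hJ (mk_code_le aleph0_le_continuum hG)
  let P := D.system decode
  have hcomplete (A : Set P.Algebra) (hA : #A < κ) : IsAlephZeroIdealComplete A := by
    choose F hF using ConstraintSystem.exists_finset (P := P)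
    have hmk : #(⋃ b : A, Prod.fst '' (F b : Set (Ladder.Index κ.ord.ToType (Set ℕ)))) < κ := by
      refine (mk_iUnion_le _).trans_lt ?_
      have hsup : ⨆ b : A, #(Prod.fst '' (F b : Set (Ladder.Index κ.ord.ToType (Set ℕ)))) ≤ ℵ₀ :=
        ciSup_le' fun b => le_aleph0_iff_set_countable.2 ((F b).countable_toSet.image _)
      exact (mul_le_mul' le_rfl hsup).trans_lt (mul_lt_of_lt hκ.aleph0_le hA hω)
    obtain ⟨γ, hγ⟩ := exists_gt_of_mk_lt hκ hmk
    refine Ladder.isAlephZeroIdealComplete_of_subset hdec hD (β := γ) fun b hb => ?_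
    have hsub : (F b : Set (Ladder.Index κ.ord.ToType (Set ℕ))) ⊆ {g | g.1 < γ} := fun g hg =>
      hγ _ (mem_iUnion.2 ⟨⟨b, hb⟩, mem_image_of_mem _ hg⟩)
    exact ConstraintSystem.sub_mono hsub (hF b)
  have hrange := Ladder.not_isAlephZeroIdealComplete_range (decode := decode)
    fun X hX => (hD X hX hK.some).imp fun _ h => h.2
  refine ⟨P.Algebra, inferInstance, le_antisymm ?_ ?_,
    fun c hc _ => ConstraintSystem.isKappaIdeal hc.aleph0_le, le_antisymm ?_ ?_⟩
  · refine (ConstraintSystem.mk_alg_le _).trans (max_le ?_ aleph0_le_continuum)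
    rwa [mk_univ]
  · exact hJ.ge.trans (Ladder.mk_le_mk_algebra hdec)
  · have hle : emcee P.Algebra ≤ #(range fun α => P.gen (α, none)) := by
      refine csInf_le' ?_
      exact ⟨_, hrange, rfl⟩
    refine hle.trans (mk_range_le.trans ?_)
    rw [mk_ord_toType]
  · have hne : {c | ∃ A : Set P.Algebra, ¬ IsAlephZeroIdealComplete A ∧ #A = c}.Nonempty :=
      ⟨_, _, hrange, rfl⟩
    refine le_csInf hne ?_
    rintro c ⟨A, hA, rfl⟩
    by_contra! hlt
    exact hA (hcomplete A hlt)

theorem mainTheorem3 :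
    (∀ κ : Cardinal.{0}, κ.IsRegular → κ ≤ 𝔠 → cofCountableSubsets κ = κ →
      ∃ (B : Type) (_ : BooleanAlgebra B), #B = 𝔠 ∧ IsStarIdeal B ∧ emcee B = κ) ∧
    (Cardinal.IsRegular (𝔠 : Cardinal.{0}) →
      ∃ (B : Type) (_ : BooleanAlgebra B), #B = 𝔠 ∧ IsCohenParovicenko B) :=
  ⟨fun _ => exists_isStarIdeal_emcee_eq,
    fun h => exists_isStarIdeal_emcee_eq h le_rfl cofCountableSubsets_continuum⟩
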